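/- Let $q\in\mathbb C$ with $0<|q|<1$. For $x,p\in\mathbb C$ with $|p|<1$ write $(x;p)_n=\prod_{i=0}^{n-1}(1-p^i x)$ for $n\in\mathbb Z_{\ge 0}$, and $(x;p)_\infty=\prod_{i=0}^{\infty}(1-p^i x)$. Put $$G_q(z)=\frac{(-qz^{-1};q)_\infty}{(z;q)_\infty},\qquad c(q)=\frac{(q;q)_\infty^2}{(q^2;q^2)_\infty},\qquad \psi^0(z,w)=c(q)\,G_q(-qz)\,G_q(w^{-1})\,G_q(wz^{-1}),$$ and, for $m,e\in\mathbb Z$, $$\psi(z,m)=\frac{(-q^{1-m}/z;q^2)_\infty}{(-q^{1-m}z;q^2)_\infty},\qquad I^\Delta(m,e)(q)=(-q)^e\sum_{n=\max\{0,-e\}}^\infty(-1)^n\frac{q^{\,n(n+1)-(2n+e)m}}{(q^2;q^2)_n\,(q^2;q^2)_{n+e}} .$$ (Thus $I^\Delta(m,e)(q)=(-q)^eI_\Delta(m,e)(q^2)$, where $I_\Delta(m,e)(q)=\sum_{n\ge\max\{0,-e\}}(-1)^n q^{\frac12n(n+1)-(n+\frac12e)m}/\bigl((q;q)_n(q;q)_{n+e}\bigr)$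 is the tetrahedron index and the square root of $q^2$ is taken to be $q$.) Then for all $z,w\in\mathbb C$ with $1<|w|<|z|<|q|^{-1}$: (a) $\displaystyle \psi^0(z,w)=\sum_{m\in\mathbb Z}\psi(z,m)\,w^m$, where the sum is absolutely convergent; (b) $\displaystyle \psi^0(z,w)=\sum_{e,m\in\mathbb Z}I^\Delta(m,e)(q)\,z^e w^m$, where the double series is absolutely convergent. -/

import Mathlib

/-- The finite `q`-Pochhammer symbol `(x;q)_n = ∏_{i=0}^{n-1} (1 - q^i x)`. -/
noncomputable def qPoc (x q : ℂ) (n : ℕ) : ℂ :=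
  ∏ i ∈ Finset.range n, (1 - q ^ i * x)

/-- The infinite `q`-Pochhammer symbol `(x;q)_∞ = ∏_{i≥0} (1 - q^i x)` (used for `|q| < 1`). -/
noncomputable def qPocInf (x q : ℂ) : ℂ :=
  ∏' i : ℕ, (1 - q ^ i * x)

/-- `G_q(z) = (-q z⁻¹;q)_∞ / (z;q)_∞`. -/
noncomputable def Gfun (q z : ℂ) : ℂ :=
  qPocInf (-q * z⁻¹) q / qPocInf z q

/-- The constant `c(q) = (q;q)_∞² / (q²;q²)_∞`. -/
noncomputable def cConst (q : ℂ) : ℂ :=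
  qPocInf q q ^ 2 / qPocInf (q ^ 2) (q ^ 2)

/-- The tetrahedral weight `ψ⁰(z,w) = c(q) G_q(-qz) G_q(w⁻¹) G_q(w z⁻¹)`. -/
noncomputable def psiZero (q z w : ℂ) : ℂ :=
  cConst q * Gfun q (-q * z) * Gfun q w⁻¹ * Gfun q (w * z⁻¹)

/-- The quantum dilogarithm on `𝕋 × ℤ`,
`ψ(z,m) = (-q^{1-m}/z;q²)_∞ / (-q^{1-m} z;q²)_∞`. -/
noncomputable def quantumDilog (q z : ℂ) (m : ℤ) : ℂ :=
  qPocInf (-q ^ (1 - m) / z) (q ^ 2) / qPocInf (-q ^ (1 - m) * z) (q ^ 2)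

/-- The `n`-th term `(-1)^n x^{n(n+1)/2 - (n + e/2) m} / ((x)_n (x)_{n+e})` of the tetrahedron
index, where `x = p²` and the half-integral powers of `x` are taken through the square root `p`.
It is meant for `n ≥ 0` with `n + e ≥ 0`. -/
noncomputable def tetIndexTerm (m e : ℤ) (p : ℂ) (n : ℕ) : ℂ :=
  (-1) ^ n * p ^ ((n : ℤ) * (n + 1) - (2 * n + e) * m) /
    (qPoc (p ^ 2) (p ^ 2) n * qPoc (p ^ 2) (p ^ 2) ((n : ℤ) + e).toNat)

/-- The tetrahedron index `I_Δ(m,e)(x) = ∑_{n ≥ (-e)_+} tetIndexTerm`, at `x = p²` with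
`x^{1/2} = p`. The summation variable is `n = k + (-e)_+`. -/
noncomputable def tetIndex (m e : ℤ) (p : ℂ) : ℂ :=
  ∑' k : ℕ, tetIndexTerm m e p (k + (-e).toNat)

/-- `I^Δ(m,e)(q) = (-q)^e I_Δ(m,e)(q²)`, with `(q²)^{1/2} = q`. -/
noncomputable def IDelta (m e : ℤ) (q : ℂ) : ℂ :=
  (-q) ^ e * tetIndex m e q

open Filter Topology

/-! ### Pochhammer symbols -/

/-! Write α_n = (-qz;q)_n/(q;q)_n. By the q-binomial theorem, ∑ α_n (w/z)^n · ∑ α_n w^{-n} equals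
L·ψ⁰(z,w), with L independent of w (`psiZero_mul`). For (a) the coefficient of w^m must therefore be
L·ψ(z,m). At m = -M it is S_M = ∑ α_k α_{k+M} z^{-k}. Creative telescoping gives S_M a two-step
recurrence in M, which ψ(z,-M) also satisfies (`qBinomConv_add_two`, `quantumDilog_add_two`). The
ratio is 2-periodic and tends to L, so it equals L. Positive m follows from ψ(z,M) z^M = ψ(z,-M).

For (b), multiplying Euler's two expansions shows that I^Δ(m,e) is the coefficient of z^e in ψ(z,m),
but only where |q^{1-m} z| < 1. This covers the whole annulus when m ≤ 0. For m = M > 0, the same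
symmetry and uniqueness of Laurent coefficients give I^Δ(M,e) = I^Δ(-M,e+M) (`IDelta_natCast`),
which carries the expansion over. Norm bounds uniform in m then make the double series absolutely
convergent, and summing over e first reduces it to (a). -/

theorem qPoc_zero (x q : ℂ) : qPoc x q 0 = 1 := by simp [qPoc]

theorem qPoc_succ (x q : ℂ) (n : ℕ) : qPoc x q (n + 1) = qPoc x q n * (1 - q ^ n * x) := by
  simp [qPoc, Finset.prod_range_succ]

theorem summable_norm_pow_mul {q : ℂ} (hq : ‖q‖ < 1) (x : ℂ) :
    Summable (fun i : ℕ => ‖-(q ^ i * x)‖) := by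
  simpa [norm_mul, norm_pow] using (summable_geometric_of_lt_one (norm_nonneg q) hq).mul_right ‖x‖

theorem multipliable_one_sub_pow_mul {q : ℂ} (hq : ‖q‖ < 1) (x : ℂ) :
    Multipliable (fun i : ℕ => 1 - q ^ i * x) := by
  simpa [sub_eq_add_neg] using multipliable_one_add_of_summable (summable_norm_pow_mul hq x)

theorem tendsto_qPoc {q : ℂ} (hq : ‖q‖ < 1) (x : ℂ) :
    Tendsto (qPoc x q) atTop (𝓝 (qPocInf x q)) :=
  (multipliable_one_sub_pow_mul hq x).hasProd.tendsto_prod_nat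

theorem qPoc_succ' (x q : ℂ) (n : ℕ) : qPoc x q (n + 1) = (1 - x) * qPoc (q * x) q n := by
  simp only [qPoc, Finset.prod_range_succ', pow_zero, one_mul, mul_comm (1 - x)]
  congr 1
  exact Finset.prod_congr rfl fun i _ => by ring

theorem qPocInf_eq_mul {q : ℂ} (hq : ‖q‖ < 1) (x : ℂ) :
    qPocInf x q = (1 - x) * qPocInf (q * x) q := by
  refine tendsto_nhds_unique ((tendsto_add_atTop_iff_nat 1).2 (tendsto_qPoc hq x)) ?_
  simp_rw [qPoc_succ']
  exact (tendsto_qPoc hq _).const_mul _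

theorem qPocInf_zero (q : ℂ) : qPocInf 0 q = 1 := by simp [qPocInf]

theorem qPocInf_mul_neg {q : ℂ} (hq : ‖q‖ < 1) (x : ℂ) :
    qPocInf x q * qPocInf (-x) q = qPocInf (x ^ 2) (q ^ 2) := by
  have hq2 : ‖q ^ 2‖ < 1 := by
    rw [norm_pow]; exact pow_lt_one₀ (norm_nonneg q) hq two_ne_zero
  refine tendsto_nhds_unique ((tendsto_qPoc hq x).mul (tendsto_qPoc hq (-x))) ?_
  refine (tendsto_qPoc hq2 (x ^ 2)).congr fun n => ?_
  simp only [qPoc, ← Finset.prod_mul_distrib]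
  exact Finset.prod_congr rfl fun i _ => by ring

theorem one_sub_pow_succ_ne_zero {q : ℂ} (hq : ‖q‖ < 1) (n : ℕ) : 1 - q ^ (n + 1) ≠ 0 := by
  intro h
  have : ‖q ^ (n + 1)‖ = 1 := by rw [← sub_eq_zero.1 h, norm_one]
  rw [norm_pow] at this
  exact (pow_lt_one₀ (norm_nonneg q) hq (Nat.succ_ne_zero n)).ne this

theorem qPoc_self_ne_zero {q : ℂ} (hq : ‖q‖ < 1) (n : ℕ) : qPoc q q n ≠ 0 := by
  refine Finset.prod_ne_zero_iff.2 fun i _ => ?_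
  rw [← pow_succ]
  exact one_sub_pow_succ_ne_zero hq i

/-! ### The `q`-binomial theorem and Euler's identities -/

/-- The coefficient `(a;q)_n / (q;q)_n` of the `q`-binomial series. -/
noncomputable def qBinomCoeff (a q : ℂ) (n : ℕ) : ℂ := qPoc a q n / qPoc q q n

theorem qBinomCoeff_zero (a q : ℂ) : qBinomCoeff a q 0 = 1 := by simp [qBinomCoeff, qPoc_zero]

theorem qBinomCoeff_succ {q : ℂ} (hq : ‖q‖ < 1) (a : ℂ) (n : ℕ) :
    qBinomCoeff a q (n + 1) * (1 - q ^ (n + 1)) = qBinomCoeff a q n * (1 - q ^ n * a) := by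
  have h1 := one_sub_pow_succ_ne_zero hq n
  have h2 := qPoc_self_ne_zero hq n
  have h3 : (1 - q ^ n * q) ≠ 0 := by rwa [← pow_succ]
  simp only [qBinomCoeff, qPoc_succ]
  rw [pow_succ]
  field_simp

/-- Ratio test phrased through a recursion, so that terms of `f` may vanish. -/
theorem summable_of_ratio_tendsto {f ρ : ℕ → ℂ} {l : ℂ} (hl : ‖l‖ < 1)
    (hf : ∀ n, f (n + 1) = ρ n * f n) (hρ : Tendsto ρ atTop (𝓝 l)) :
    Summable (fun n => ‖f n‖) := by
  obtain ⟨r, hlr, hr⟩ := exists_between hl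
  refine summable_of_ratio_norm_eventually_le hr ?_
  filter_upwards [hρ.norm.eventually_lt_const hlr] with n hn
  rw [norm_norm, norm_norm, hf, norm_mul]
  exact mul_le_mul_of_nonneg_right hn.le (norm_nonneg _)

theorem summable_qBinom {q x : ℂ} (hq : ‖q‖ < 1) (a : ℂ) (hx : ‖x‖ < 1) :
    Summable (fun n => ‖qBinomCoeff a q n * x ^ n‖) := by
  have hp : Tendsto (fun n : ℕ => q ^ n) atTop (𝓝 0) := tendsto_pow_atTop_nhds_zero_of_norm_lt_one hq
  refine summable_of_ratio_tendsto (l := (1 - 0 * a) / (1 - 0) * x)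
    (ρ := fun n => (1 - q ^ n * a) / (1 - q ^ (n + 1)) * x) (by simpa using hx) (fun n => ?_) ?_
  · have h1 := one_sub_pow_succ_ne_zero hq n
    have h2 := qBinomCoeff_succ hq a n
    rw [pow_succ x]
    field_simp
    linear_combination x ^ n * x * h2
  · exact (((hp.mul_const a).const_sub 1).div (((tendsto_add_atTop_iff_nat 1).2 hp).const_sub 1)
      (by simp)).mul_const x

theorem norm_mul_pow_mul_le {q : ℂ} (hq : ‖q‖ < 1) (c x : ℂ) (N n : ℕ) :
    ‖c * (q ^ N * x) ^ n‖ ≤ ‖c * x ^ n‖ := by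
  rw [mul_pow, norm_mul, norm_mul, norm_mul, norm_pow, norm_pow]
  gcongr
  exact mul_le_of_le_one_left (norm_nonneg _)
    (pow_le_one₀ (by positivity) (pow_le_one₀ (norm_nonneg _) hq.le))

/-- A power series with constant term `1` tends to `1` along `q ^ N * x`. -/
theorem tendsto_tsum_pow_mul {q x : ℂ} (hq : ‖q‖ < 1) {c : ℕ → ℂ} (hc : c 0 = 1)
    (hs : Summable (fun n => ‖c n * x ^ n‖)) :
    Tendsto (fun N : ℕ => ∑' n, c n * (q ^ N * x) ^ n) atTop (𝓝 1) := by
  have hp : Tendsto (fun n : ℕ => q ^ n) atTop (𝓝 0) := tendsto_pow_atTop_nhds_zero_of_norm_lt_one hq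
  have h := tendsto_tsum_of_dominated_convergence (𝓕 := atTop)
    (f := fun (N : ℕ) n => c n * (q ^ N * x) ^ n) (g := fun n => c n * (0 * x) ^ n) hs
    (fun n => ((hp.mul_const x).pow n).const_mul _)
    (Eventually.of_forall fun N n => norm_mul_pow_mul_le hq _ _ _ _)
  rwa [tsum_eq_single 0 (fun n hn => by simp [hn]), hc, pow_zero, mul_one] at h

theorem summable_mul_pow_of_scale {q x : ℂ} (hq : ‖q‖ < 1) {c : ℕ → ℂ}
    (hs : Summable (fun n => ‖c n * x ^ n‖)) (N : ℕ) :
    Summable (fun n => ‖c n * (q ^ N * x) ^ n‖) :=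
  Summable.of_nonneg_of_le (fun _ => norm_nonneg _) (fun _ => norm_mul_pow_mul_le hq _ _ _ _) hs

theorem tsum_qBinom_functional {q x : ℂ} (hq : ‖q‖ < 1) (a : ℂ) (hx : ‖x‖ < 1) :
    (1 - x) * ∑' n, qBinomCoeff a q n * x ^ n =
      (1 - a * x) * ∑' n, qBinomCoeff a q n * (q * x) ^ n := by
  have hs := (summable_qBinom hq a hx).of_norm
  have hs' : Summable (fun n => qBinomCoeff a q n * (q * x) ^ n) := by
    simpa using (summable_mul_pow_of_scale hq (summable_qBinom hq a hx) 1).of_norm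
  have h1 : ∑' n, qBinomCoeff a q n * x ^ n - ∑' n, qBinomCoeff a q n * (q * x) ^ n =
      ∑' n, x * (qBinomCoeff a q n * x ^ n - a * (qBinomCoeff a q n * (q * x) ^ n)) := by
    -- The constant terms cancel; after an index shift the coefficient recurrence matches the series
    -- term by term.
    rw [← hs.tsum_sub hs', (hs.sub hs').tsum_eq_zero_add]
    simp only [pow_zero, sub_self, zero_add]
    refine tsum_congr fun n => ?_
    rw [mul_pow, mul_pow]
    linear_combination x ^ (n + 1) * qBinomCoeff_succ hq a n
  rw [tsum_mul_left, hs.tsum_sub (hs'.mul_left a), tsum_mul_left] at h1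
  linear_combination h1

/-- Iterate the functional equation N times and let N → ∞. The form is division-free because the
case a = 0 is what shows (x;q)_∞ ≠ 0. -/
theorem tsum_qBinom_mul {q x : ℂ} (hq : ‖q‖ < 1) (a : ℂ) (hx : ‖x‖ < 1) :
    (∑' n, qBinomCoeff a q n * x ^ n) * qPocInf x q = qPocInf (a * x) q := by
  have hN : ∀ N : ℕ, (∑' n, qBinomCoeff a q n * x ^ n) * qPoc x q N =
      qPoc (a * x) q N * ∑' n, qBinomCoeff a q n * (q ^ N * x) ^ n := by
    intro N
    induction N with
    | zero => simp [qPoc_zero]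
    | succ N ih =>
      have hx' : ‖q ^ N * x‖ < 1 := by
        rw [norm_mul, norm_pow]
        exact (mul_le_of_le_one_left (norm_nonneg _)
          (pow_le_one₀ (norm_nonneg _) hq.le)).trans_lt hx
      have h := tsum_qBinom_functional hq a hx'
      rw [← mul_assoc q, ← pow_succ'] at h
      rw [qPoc_succ, qPoc_succ, ← mul_assoc, ih]
      linear_combination qPoc (a * x) q N * h
  have h1 := (tendsto_qPoc hq x).const_mul (∑' n, qBinomCoeff a q n * x ^ n)
  have h2 := (tendsto_qPoc hq (a * x)).mul
    (tendsto_tsum_pow_mul hq (qBinomCoeff_zero a q) (summable_qBinom hq a hx))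
  rw [mul_one] at h2
  exact tendsto_nhds_unique h1 (h2.congr fun N => (hN N).symm)

theorem qPocInf_ne_zero {q x : ℂ} (hq : ‖q‖ < 1) (hx : ‖x‖ < 1) : qPocInf x q ≠ 0 := by
  intro h
  have := tsum_qBinom_mul hq 0 hx
  rw [h, mul_zero, zero_mul, qPocInf_zero] at this
  exact zero_ne_one this

theorem tsum_qBinom {q x : ℂ} (hq : ‖q‖ < 1) (a : ℂ) (hx : ‖x‖ < 1) :
    ∑' n, qBinomCoeff a q n * x ^ n = qPocInf (a * x) q / qPocInf x q :=
  eq_div_of_mul_eq (qPocInf_ne_zero hq hx) (tsum_qBinom_mul hq a hx)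

/-- The coefficient of Euler's expansion of `(x;q)_∞`. -/
noncomputable def eulerCoeff (q : ℂ) (n : ℕ) : ℂ := (-1) ^ n * q ^ (n.choose 2) / qPoc q q n

theorem eulerCoeff_succ {q : ℂ} (hq : ‖q‖ < 1) (n : ℕ) :
    eulerCoeff q (n + 1) * (1 - q ^ (n + 1)) = -q ^ n * eulerCoeff q n := by
  have h2 := qPoc_self_ne_zero hq n
  have h1 := one_sub_pow_succ_ne_zero hq n
  have h3 : (1 - q ^ n * q) ≠ 0 := by rwa [← pow_succ]
  simp only [eulerCoeff, qPoc_succ, Nat.choose_succ_succ' n 1, Nat.choose_one_right, pow_add]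
  field_simp

theorem summable_euler {q : ℂ} (hq : ‖q‖ < 1) (x : ℂ) :
    Summable (fun n => ‖eulerCoeff q n * x ^ n‖) := by
  have hp : Tendsto (fun n : ℕ => q ^ n) atTop (𝓝 0) := tendsto_pow_atTop_nhds_zero_of_norm_lt_one hq
  refine summable_of_ratio_tendsto (l := -0 / (1 - 0) * x)
    (ρ := fun n => -q ^ n / (1 - q ^ (n + 1)) * x) (by simp) (fun n => ?_) ?_
  · have h1 := one_sub_pow_succ_ne_zero hq n
    have h2 := eulerCoeff_succ hq n
    rw [pow_succ x]
    field_simp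
    linear_combination x ^ n * x * h2
  · exact (hp.neg.div (((tendsto_add_atTop_iff_nat 1).2 hp).const_sub 1)
      (by simp)).mul_const x

theorem tsum_euler_functional {q : ℂ} (hq : ‖q‖ < 1) (x : ℂ) :
    ∑' n, eulerCoeff q n * x ^ n = (1 - x) * ∑' n, eulerCoeff q n * (q * x) ^ n := by
  have hs := (summable_euler hq x).of_norm
  have hs' := (summable_euler hq (q * x)).of_norm
  have h1 : ∑' n, eulerCoeff q n * x ^ n - ∑' n, eulerCoeff q n * (q * x) ^ n =
      ∑' n, -x * (eulerCoeff q n * (q * x) ^ n) := by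
    rw [← hs.tsum_sub hs', (hs.sub hs').tsum_eq_zero_add]
    simp only [pow_zero, sub_self, zero_add]
    refine tsum_congr fun n => ?_
    rw [mul_pow, mul_pow]
    linear_combination x ^ (n + 1) * eulerCoeff_succ hq n
  rw [tsum_mul_left] at h1
  linear_combination h1

theorem tsum_euler {q : ℂ} (hq : ‖q‖ < 1) (x : ℂ) :
    ∑' n, eulerCoeff q n * x ^ n = qPocInf x q := by
  have hN : ∀ N : ℕ, ∑' n, eulerCoeff q n * x ^ n =
      qPoc x q N * ∑' n, eulerCoeff q n * (q ^ N * x) ^ n := by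
    intro N
    induction N with
    | zero => simp [qPoc_zero]
    | succ N ih =>
      have h := tsum_euler_functional hq (q ^ N * x)
      rw [← mul_assoc, ← pow_succ'] at h
      rw [qPoc_succ, ih]
      linear_combination qPoc x q N * h
  have h2 := (tendsto_qPoc hq x).mul
    (tendsto_tsum_pow_mul hq (c := eulerCoeff q) (by simp [eulerCoeff, qPoc_zero])
      (summable_euler hq x))
  rw [mul_one] at h2
  exact tendsto_nhds_unique tendsto_const_nhds (h2.congr fun N => (hN N).symm)

/-! ### Laurent series -/

/-- Pairs of natural numbers, parametrised by their difference and their minimum. -/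
def intNatEquiv : ℤ × ℕ ≃ ℕ × ℕ where
  toFun p := (p.2 + p.1.toNat, p.2 + (-p.1).toNat)
  invFun p := ((p.1 : ℤ) - p.2, min p.1 p.2)
  left_inv p := by
    ext
    · simp
    · simp; omega
  right_inv p := by ext <;> (simp; omega)

/-- The coefficient of index `m` of the product of `∑ a n X ^ n` and `∑ b n X ^ (-n)`. -/
noncomputable def laurentConv (a b : ℕ → ℂ) (m : ℤ) : ℂ :=
  ∑' k : ℕ, a (k + m.toNat) * b (k + (-m).toNat)

theorem laurentConv_summable_aux {a b : ℕ → ℂ} (ha : Summable fun n => ‖a n‖)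
    (hb : Summable fun n => ‖b n‖) :
    HasSum (fun p : ℤ × ℕ => ‖a (p.2 + p.1.toNat) * b (p.2 + (-p.1).toNat)‖)
      ((∑' n, ‖a n‖) * ∑' n, ‖b n‖) := by
  have h : Summable (fun p : ℕ × ℕ => ‖a p.1‖ * ‖b p.2‖) :=
    summable_mul_of_summable_norm (f := fun n => ‖a n‖) (g := fun n => ‖b n‖)
      (by simpa using ha) (by simpa using hb)
  have h2 := (intNatEquiv.hasSum_iff).2 h.hasSum
  rw [← tsum_mul_tsum_of_summable_norm (f := fun n => ‖a n‖) (g := fun n => ‖b n‖)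
    (by simpa using ha) (by simpa using hb)] at h2
  simpa [Function.comp_def, intNatEquiv] using h2

/-- The explicit bound is what later gives estimates uniform in m. -/
theorem laurentConv_norm {a b : ℕ → ℂ} (ha : Summable fun n => ‖a n‖)
    (hb : Summable fun n => ‖b n‖) :
    Summable (fun m => ‖laurentConv a b m‖) ∧
      ∑' m, ‖laurentConv a b m‖ ≤ (∑' n, ‖a n‖) * ∑' n, ‖b n‖ := by
  have h := laurentConv_summable_aux ha hb
  have h1 := h.prod_fiberwise fun m => (h.summable.prod_factor m).hasSum
  have hle : ∀ m, ‖laurentConv a b m‖ ≤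
      ∑' k : ℕ, ‖a (k + m.toNat) * b (k + (-m).toNat)‖ := fun m =>
    norm_tsum_le_tsum_norm (h.summable.prod_factor m)
  have hs := Summable.of_nonneg_of_le (fun _ => norm_nonneg _) hle h1.summable
  exact ⟨hs, (hs.tsum_le_tsum hle h1.summable).trans h1.tsum_eq.le⟩

theorem hasSum_laurentConv {a b : ℕ → ℂ} (ha : Summable fun n => ‖a n‖)
    (hb : Summable fun n => ‖b n‖) :
    HasSum (laurentConv a b) ((∑' n, a n) * ∑' n, b n) := by
  have h := (intNatEquiv.hasSum_iff).2 (summable_mul_of_summable_norm ha hb).hasSum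
  rw [← tsum_mul_tsum_of_summable_norm ha hb] at h
  exact h.prod_fiberwise fun m => (h.summable.prod_factor m).hasSum

theorem laurentConv_mul_pow (a b : ℕ → ℂ) {x : ℂ} (hx : x ≠ 0) (m : ℤ) :
    laurentConv (fun n => a n * x ^ n) (fun n => b n * x⁻¹ ^ n) m = laurentConv a b m * x ^ m := by
  rw [laurentConv, laurentConv, ← tsum_mul_right]
  refine tsum_congr fun k => ?_
  have : x ^ m = x ^ (k + m.toNat) * x⁻¹ ^ (k + (-m).toNat) := by
    rw [inv_pow, ← zpow_natCast, ← zpow_natCast, ← zpow_neg, ← zpow_add₀ hx]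
    congr 1
    push_cast
    omega
  rw [this]
  ring

/-- An absolutely convergent trigonometric series that vanishes identically has zero
coefficients. -/
theorem laurent_coeff_eq_zero {c : ℤ → ℂ} (hc : Summable fun m => ‖c m‖)
    (h : ∀ u : ℂ, ‖u‖ = 1 → HasSum (fun m => c m * u ^ m) 0) (j : ℤ) : c j = 0 := by
  -- Multiply the series at u = exp(it) by exp(-ijt) and integrate termwise; only m = j survives.
  have hI : HasSum (fun m : ℤ => ∫ t in (0 : ℝ)..2 * Real.pi,
      c m * Complex.exp (((m - j : ℤ) : ℂ) * Complex.I * t))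
      (∫ t in (0 : ℝ)..2 * Real.pi, (0 : ℂ)) := by
    refine intervalIntegral.hasSum_integral_of_dominated_convergence (fun m _ => ‖c m‖)
      (fun m => (by fun_prop : Continuous _).aestronglyMeasurable) (fun m => ?_)
      (Eventually.of_forall fun _ _ => hc) (by simp) (Eventually.of_forall fun t _ => ?_)
    · refine Eventually.of_forall fun t _ => ?_
      have : ‖Complex.exp (((m - j : ℤ) : ℂ) * Complex.I * t)‖ = 1 := by
        rw [show ((m - j : ℤ) : ℂ) * Complex.I * t = (((m - j : ℤ) * t : ℝ) : ℂ) * Complex.I by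
          push_cast; ring]
        exact Complex.norm_exp_ofReal_mul_I _
      rw [norm_mul, this, mul_one]
    · have h0 := (h (Complex.exp (t * Complex.I)) (Complex.norm_exp_ofReal_mul_I t)).mul_right
        (Complex.exp (-(j : ℂ) * Complex.I * t))
      rw [zero_mul] at h0
      refine (congrArg (HasSum · (0 : ℂ)) (funext fun m => ?_)).mp h0
      rw [mul_assoc, ← Complex.exp_int_mul, ← Complex.exp_add]
      congr 2
      push_cast
      ring
  rw [intervalIntegral.integral_zero] at hI
  have h1 := hI.unique (hasSum_single j fun m hm => ?_)
  · simp [Real.pi_ne_zero] at h1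
    exact h1
  · have hne : ((m - j : ℤ) : ℂ) * Complex.I ≠ 0 :=
      mul_ne_zero (Int.cast_ne_zero.2 (sub_ne_zero.2 hm)) Complex.I_ne_zero
    rw [intervalIntegral.integral_const_mul, integral_exp_mul_complex hne,
      show ((m - j : ℤ) : ℂ) * Complex.I * ((2 * Real.pi : ℝ) : ℂ) =
        ((m - j : ℤ) : ℂ) * (2 * Real.pi * Complex.I) by push_cast; ring,
      Complex.exp_int_mul_two_pi_mul_I]
    simp

/-! ### The quantum dilogarithm -/

theorem norm_sq_lt_one {q : ℂ} (hq : ‖q‖ < 1) : ‖q ^ 2‖ < 1 := by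
  rw [norm_pow]; exact pow_lt_one₀ (norm_nonneg q) hq two_ne_zero

/-- Raising m by 2 divides both arguments by q², the base, so each product gains one factor. -/
theorem quantumDilog_add_two {q x : ℂ} (hq0 : q ≠ 0) (hq : ‖q‖ < 1)
    (hx : ∀ j : ℤ, 1 + q ^ j * x ≠ 0) (m : ℤ) :
    quantumDilog q x (m + 2) * (1 + q ^ (-1 - m) * x) =
      quantumDilog q x m * (1 + q ^ (-1 - m) / x) := by
  have h1 : q ^ (1 - (m + 2)) = q ^ (-1 - m) := by congr 1; ring
  have h2 : q ^ (1 - m) = q ^ 2 * q ^ (-1 - m) := by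
    rw [← zpow_natCast q 2, ← zpow_add₀ hq0]; congr 1; push_cast; ring
  have h3 := hx (-1 - m)
  have hq2 := norm_sq_lt_one hq
  simp only [quantumDilog]
  rw [qPocInf_eq_mul hq2 (-q ^ (1 - (m + 2)) / x), qPocInf_eq_mul hq2 (-q ^ (1 - (m + 2)) * x),
    h1, h2]
  rw [show 1 - -q ^ (-1 - m) * x = 1 + q ^ (-1 - m) * x by ring,
    show 1 - -q ^ (-1 - m) / x = 1 + q ^ (-1 - m) / x by ring,
    show q ^ 2 * (-q ^ (-1 - m) / x) = -(q ^ 2 * q ^ (-1 - m)) / x by ring,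
    show q ^ 2 * (-q ^ (-1 - m) * x) = -(q ^ 2 * q ^ (-1 - m)) * x by ring]
  rw [mul_div_mul_comm]
  field_simp

theorem quantumDilog_natCast {q x : ℂ} (hq0 : q ≠ 0) (hq : ‖q‖ < 1) (hx0 : x ≠ 0)
    (hx : ∀ j : ℤ, 1 + q ^ j * x ≠ 0) (M : ℕ) :
    quantumDilog q x M * x ^ M = quantumDilog q x (-M) := by
  induction M using Nat.twoStepInduction with
  | zero => simp
  | one =>
    have h := quantumDilog_add_two hq0 hq hx (-1)
    have h0 := hx 0
    norm_num at h h0 ⊢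
    field_simp at h
    apply mul_left_cancel₀ h0
    linear_combination h
  | more M ih _ =>
    -- The recurrence is used at M and, reflected, at -M-2; its factors there involve q^{-(M+1)} and
    -- q^{M+1}.
    have h1 := quantumDilog_add_two hq0 hq hx M
    have h2 := quantumDilog_add_two hq0 hq hx (-M - 2)
    have e1 : q ^ (-1 - (M : ℤ)) = (q ^ (M + 1))⁻¹ := by
      rw [← zpow_natCast, ← zpow_neg]; congr 1; push_cast; ring
    have e2 : q ^ (-1 - (-(M : ℤ) - 2)) = q ^ (M + 1) := by
      rw [← zpow_natCast]; congr 1; push_cast; ring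
    have n1 := hx (-1 - M)
    rw [e1] at h1 n1
    rw [e2, show -(M : ℤ) - 2 + 2 = -M by ring, ← ih] at h2
    push_cast
    rw [show -((M : ℤ) + 2) = -M - 2 by ring]
    have hQ : q ^ (M + 1) ≠ 0 := pow_ne_zero _ hq0
    generalize q ^ (M + 1) = Q at *
    have n2 : Q + x ≠ 0 := by
      intro h; apply n1; field_simp; simpa using h
    field_simp at h1 h2
    apply mul_left_cancel₀ n2
    rw [pow_add]
    linear_combination x ^ M * x * h1 + h2

/-- Base and scale are separate because ψ has base q² while its arguments move by powers of q. -/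
theorem tendsto_qPocInf_pow_mul {p q : ℂ} (hp : ‖p‖ < 1) (hq : ‖q‖ < 1) (x : ℂ) :
    Tendsto (fun N : ℕ => qPocInf (q ^ N * x) p) atTop (𝓝 1) := by
  simp_rw [← tsum_euler hp]
  exact tendsto_tsum_pow_mul hq (by simp [eulerCoeff, qPoc_zero]) (summable_euler hp x)

theorem quantumDilog_neg_natCast (q x : ℂ) (M : ℕ) :
    quantumDilog q x (-M) =
      qPocInf (q ^ M * (-q / x)) (q ^ 2) / qPocInf (q ^ M * (-q * x)) (q ^ 2) := by
  have : q ^ (1 - -(M : ℤ)) = q ^ M * q := by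
    rw [← pow_succ, ← zpow_natCast]; congr 1; push_cast; ring
  rw [quantumDilog, this]
  congr 2 <;> ring

theorem tendsto_quantumDilog_neg {q : ℂ} (hq : ‖q‖ < 1) (x : ℂ) :
    Tendsto (fun M : ℕ => quantumDilog q x (-M)) atTop (𝓝 1) := by
  simp_rw [quantumDilog_neg_natCast]
  have h := (tendsto_qPocInf_pow_mul (norm_sq_lt_one hq) hq (-q / x)).div
    (tendsto_qPocInf_pow_mul (norm_sq_lt_one hq) hq (-q * x)) one_ne_zero
  rwa [div_one] at h

theorem norm_pow_mul_lt_one {q x : ℂ} (hq : ‖q‖ < 1) (hx : ‖x‖ < 1) (M : ℕ) :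
    ‖q ^ M * x‖ < 1 := by
  rw [norm_mul, norm_pow]
  exact (mul_le_of_le_one_left (norm_nonneg _) (pow_le_one₀ (norm_nonneg _) hq.le)).trans_lt hx

theorem quantumDilog_neg_ne_zero {q x : ℂ} (hq : ‖q‖ < 1) (h1 : 1 < ‖x‖)
    (h2 : ‖q * x‖ < 1) (M : ℕ) : quantumDilog q x (-M) ≠ 0 := by
  rw [quantumDilog_neg_natCast]
  refine div_ne_zero (qPocInf_ne_zero (norm_sq_lt_one hq) (norm_pow_mul_lt_one hq ?_ M))
    (qPocInf_ne_zero (norm_sq_lt_one hq) (norm_pow_mul_lt_one hq ?_ M))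
  · rw [norm_div, norm_neg]
    exact (div_lt_one (by linarith)).2 (hq.trans h1)
  · rwa [neg_mul, norm_neg]

/-- |q^j z| exceeds 1 for j ≤ 0 and is at most |qz| < 1 for j ≥ 1, so q^j z is never -1. -/
theorem one_add_zpow_mul_ne_zero {q z : ℂ} (hq0 : q ≠ 0) (hq : ‖q‖ < 1) (h1 : 1 < ‖z‖)
    (h2 : ‖q * z‖ < 1) (j : ℤ) : 1 + q ^ j * z ≠ 0 := by
  intro h
  have hn : ‖q‖ ^ j * ‖z‖ = 1 := by
    rw [← norm_zpow, ← norm_mul, show q ^ j * z = -1 by linear_combination h, norm_neg, norm_one]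
  have hq' : 0 < ‖q‖ := norm_pos_iff.2 hq0
  rw [norm_mul] at h2
  rcases le_or_gt j 0 with hj | hj
  · have := one_le_zpow_of_nonpos₀ hq' hq.le hj
    nlinarith
  · have : ‖q‖ ^ j ≤ ‖q‖ ^ (1 : ℤ) := zpow_le_zpow_right_of_le_one₀ hq' hq.le (by omega)
    rw [zpow_one] at this
    nlinarith

/-! ### Summation of the convolution by telescoping -/

theorem tendsto_qBinomCoeff {q : ℂ} (hq : ‖q‖ < 1) (a : ℂ) :
    Tendsto (qBinomCoeff a q) atTop (𝓝 (qPocInf a q / qPocInf q q)) :=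
  (tendsto_qPoc hq a).div (tendsto_qPoc hq q) (qPocInf_ne_zero hq hq)

theorem exists_norm_qBinomCoeff_le {q : ℂ} (hq : ‖q‖ < 1) (a : ℂ) :
    ∃ C, ∀ n, ‖qBinomCoeff a q n‖ ≤ C := by
  obtain ⟨C, hC⟩ := (Metric.isBounded_range_of_tendsto _ (tendsto_qBinomCoeff hq a)).exists_norm_le
  exact ⟨C, fun n => hC _ ⟨n, rfl⟩⟩

/-- The sum `∑ α_k α_{k+M} x^k` for `α_n = (a;q)_n / (q;q)_n`. -/
noncomputable def qBinomConv (a q x : ℂ) (M : ℕ) : ℂ :=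
  ∑' k : ℕ, qBinomCoeff a q k * x ^ k * qBinomCoeff a q (k + M)

theorem summable_qBinomConv {q x : ℂ} (hq : ‖q‖ < 1) (a : ℂ) (hx : ‖x‖ < 1) (M : ℕ) :
    Summable fun k : ℕ => qBinomCoeff a q k * x ^ k * qBinomCoeff a q (k + M) := by
  obtain ⟨C, hC⟩ := exists_norm_qBinomCoeff_le hq a
  refine Summable.of_norm_bounded ((summable_qBinom hq a hx).mul_right C) fun k => ?_
  rw [norm_mul]
  exact mul_le_mul_of_nonneg_left (hC _) (norm_nonneg _)

theorem tendsto_qBinomConv {q x : ℂ} (hq : ‖q‖ < 1) (a : ℂ) (hx : ‖x‖ < 1) :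
    Tendsto (qBinomConv a q x) atTop
      (𝓝 (qPocInf (a * x) q / qPocInf x q * (qPocInf a q / qPocInf q q))) := by
  obtain ⟨C, hC⟩ := exists_norm_qBinomCoeff_le hq a
  rw [← tsum_qBinom hq a hx, ← tsum_mul_right]
  refine tendsto_tsum_of_dominated_convergence ((summable_qBinom hq a hx).mul_right C)
    (fun k => ?_) (Eventually.of_forall fun M k => ?_)
  · refine Tendsto.const_mul _ ?_
    simp_rw [add_comm k]
    exact (tendsto_add_atTop_iff_nat k).2 (tendsto_qBinomCoeff hq a)
  · rw [norm_mul]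
    exact mul_le_mul_of_nonneg_left (hC _) (norm_nonneg _)

theorem qBinomConv_add_two {q z : ℂ} (hq : ‖q‖ < 1) (hz : 1 < ‖z‖) (M : ℕ) :
    qBinomConv (-q * z) q z⁻¹ (M + 2) * (1 + q ^ (M + 1) / z) =
      qBinomConv (-q * z) q z⁻¹ M * (1 + q ^ (M + 1) * z) := by
  have hz0 : z ≠ 0 := norm_pos_iff.1 (by linarith)
  have hx : ‖z⁻¹‖ < 1 := by rw [norm_inv]; exact inv_lt_one_of_one_lt₀ hz
  set α := qBinomCoeff (-q * z) q with hα
  have hrec : ∀ n, α (n + 1) * (1 - q ^ (n + 1)) = α n * (1 + q ^ (n + 1) * z) := fun n => by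
    rw [hα, qBinomCoeff_succ hq, pow_succ]; ring
  -- Telescoping certificate: the factor 1 - q^k makes it vanish at k = 0, and α_k z^{-k} → 0 makes
  -- it vanish at infinity.
  let g : ℕ → ℂ := fun k => α k * z⁻¹ ^ k *
    (α (k + M) * (q ^ (M + 1) * (1 + z) * (1 - q ^ k) / (1 - q ^ (k + M + 1))))
  have hs := ((summable_qBinomConv hq (-q * z) hx (M + 2)).mul_right (1 + q ^ (M + 1) / z)).sub
    ((summable_qBinomConv hq (-q * z) hx M).mul_right (1 + q ^ (M + 1) * z))
  have hg : ∀ k, α k * z⁻¹ ^ k * α (k + (M + 2)) * (1 + q ^ (M + 1) / z) -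
      α k * z⁻¹ ^ k * α (k + M) * (1 + q ^ (M + 1) * z) = g (k + 1) - g k := by
    intro k
    have r1 := hrec k
    have r2 := hrec (k + M)
    have r3 := hrec (k + M + 1)
    have n1 := one_sub_pow_succ_ne_zero hq k
    have n2 := one_sub_pow_succ_ne_zero hq (k + M)
    have n3 := one_sub_pow_succ_ne_zero hq (k + M + 1)
    simp only [g]
    rw [show k + 1 + M = k + M + 1 by ring, show k + (M + 2) = k + M + 1 + 1 by ring]
    rw [eq_div_of_mul_eq n3 r3, eq_div_of_mul_eq n2 r2, eq_div_of_mul_eq n1 r1]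
    simp only [pow_succ, pow_add] at n1 n2 n3 ⊢
    generalize z⁻¹ ^ k = y
    generalize q ^ k = u at *
    generalize q ^ M = Q at *
    have n4 : 1 - u * Q * q ^ 2 ≠ 0 := by rwa [sq, ← mul_assoc]
    field_simp
    ring
  have hg0 : g 0 = 0 := by simp [g]
  have hlim : Tendsto g atTop (𝓝 0) := by
    have hp : Tendsto (fun n : ℕ => q ^ n) atTop (𝓝 0) :=
      tendsto_pow_atTop_nhds_zero_of_norm_lt_one hq
    have t1 := (summable_qBinom hq (-q * z) hx).of_norm.tendsto_atTop_zero
    have t2 := (tendsto_add_atTop_iff_nat M).2 (tendsto_qBinomCoeff hq (-q * z))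
    have t3 : Tendsto (fun k : ℕ => q ^ (M + 1) * (1 + z) * (1 - q ^ k) / (1 - q ^ (k + M + 1)))
        atTop (𝓝 (q ^ (M + 1) * (1 + z) * (1 - 0) / (1 - 0))) :=
      ((hp.const_sub 1).const_mul _).div
        (((tendsto_add_atTop_iff_nat (M + 1)).2 hp).const_sub 1) (by simp)
    have t := t1.mul (t2.mul t3)
    rwa [zero_mul] at t
  have hsum := hs.hasSum.tendsto_sum_nat
  simp_rw [← hα, hg, Finset.sum_range_sub, hg0, sub_zero] at hsum
  have h0 := tendsto_nhds_unique hsum hlim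
  simp_rw [← hg] at h0
  rw [((summable_qBinomConv hq (-q * z) hx (M + 2)).mul_right _).tsum_sub
    ((summable_qBinomConv hq (-q * z) hx M).mul_right _), tsum_mul_right, tsum_mul_right] at h0
  exact sub_eq_zero.1 h0

theorem eq_of_tendsto_of_add_two {s : ℕ → ℂ} {l : ℂ} (h : ∀ n, s (n + 2) = s n)
    (hl : Tendsto s atTop (𝓝 l)) (n : ℕ) : s n = l := by
  have hN : ∀ N, s (n + 2 * N) = s n := by
    intro N
    induction N with
    | zero => rfl
    | succ N ih => rw [show n + 2 * (N + 1) = n + 2 * N + 2 by ring, h, ih]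
  have ht : Tendsto (fun N : ℕ => n + 2 * N) atTop atTop :=
    tendsto_atTop_mono (fun N => by simp only [id]; omega) tendsto_id
  exact tendsto_nhds_unique (tendsto_const_nhds.congr fun N => (hN N).symm) (hl.comp ht)

theorem qBinomConv_eq {q z : ℂ} (hq0 : q ≠ 0) (hq : ‖q‖ < 1) (h1 : 1 < ‖z‖)
    (h2 : ‖q * z‖ < 1) (M : ℕ) :
    qBinomConv (-q * z) q z⁻¹ M =
      qPocInf (-q) q / qPocInf z⁻¹ q * (qPocInf (-q * z) q / qPocInf q q) *
        quantumDilog q z (-M) := by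
  have hz0 : z ≠ 0 := norm_pos_iff.1 (by linarith)
  have hx : ‖z⁻¹‖ < 1 := by rw [norm_inv]; exact inv_lt_one_of_one_lt₀ h1
  rw [← div_eq_iff (quantumDilog_neg_ne_zero hq h1 h2 M)]
  refine eq_of_tendsto_of_add_two
    (s := fun M : ℕ => qBinomConv (-q * z) q z⁻¹ M / quantumDilog q z (-M)) (fun n => ?_) ?_ M
  · have hr := qBinomConv_add_two hq h1 n
    have hf := quantumDilog_add_two hq0 hq (one_add_zpow_mul_ne_zero hq0 hq h1 h2) (-n - 2)
    have e2 : q ^ (-1 - (-(n : ℤ) - 2)) = q ^ (n + 1) := by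
      rw [← zpow_natCast]; congr 1; push_cast; ring
    rw [e2, show -(n : ℤ) - 2 + 2 = -n by ring] at hf
    have hn := one_add_zpow_mul_ne_zero hq0 hq h1 h2 (n + 1 : ℕ)
    rw [zpow_natCast] at hn
    have d1 := quantumDilog_neg_ne_zero hq h1 h2 n
    have d2 := quantumDilog_neg_ne_zero hq h1 h2 (n + 2)
    have e3 : (-((n + 2 : ℕ) : ℤ)) = -n - 2 := by push_cast; ring
    rw [e3] at d2
    simp only [e3]
    rw [div_eq_div_iff d2 d1]
    apply mul_right_cancel₀ hn
    linear_combination qBinomConv (-q * z) q z⁻¹ (n + 2) * hf + quantumDilog q z (-n - 2) * hr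
  -- The limit at infinity fixes the constant for both parities of M at once.
  · have := (tendsto_qBinomConv hq (-q * z) hx).div (tendsto_quantumDilog_neg hq z) one_ne_zero
    rwa [mul_assoc, mul_inv_cancel₀ hz0, mul_one, div_one] at this

/-- The three-factor weight as a multiple of a product of two `q`-binomial series. -/
theorem psiZero_mul {q z w : ℂ} (hq0 : q ≠ 0) (hq : ‖q‖ < 1) (h1 : 1 < ‖z‖)
    (h2 : ‖q * z‖ < 1) (hw : 1 < ‖w‖) (hwz : ‖w‖ < ‖z‖) :
    (∑' n, qBinomCoeff (-q * z) q n * (w / z) ^ n) * (∑' n, qBinomCoeff (-q * z) q n * w⁻¹ ^ n) =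
      qPocInf (-q) q / qPocInf z⁻¹ q * (qPocInf (-q * z) q / qPocInf q q) * psiZero q z w := by
  have hz0 : z ≠ 0 := norm_pos_iff.1 (by linarith)
  have hw0 : w ≠ 0 := norm_pos_iff.1 (by linarith)
  have hx : ‖z⁻¹‖ < 1 := by rw [norm_inv]; exact inv_lt_one_of_one_lt₀ h1
  have hxw : ‖w⁻¹‖ < 1 := by rw [norm_inv]; exact inv_lt_one_of_one_lt₀ hw
  have hy : ‖w / z‖ < 1 := by rw [norm_div]; exact (div_lt_one (by linarith)).2 hwz
  rw [tsum_qBinom hq _ hy, tsum_qBinom hq _ hxw]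
  have n1 := qPocInf_ne_zero hq hq
  have n2 := qPocInf_ne_zero hq hx
  have n3 : qPocInf (-q * z) q ≠ 0 := qPocInf_ne_zero hq (by rwa [neg_mul, norm_neg])
  have n4 : qPocInf (-q) q ≠ 0 := qPocInf_ne_zero hq (by rwa [norm_neg])
  -- Since (q²;q²)_∞ = (q;q)_∞ (-q;q)_∞, the constant c(q) is (q;q)_∞/(-q;q)_∞.
  rw [psiZero, cConst, Gfun, Gfun, Gfun, ← qPocInf_mul_neg hq q]
  rw [show -q * z * (w / z) = -q * (w⁻¹)⁻¹ by field_simp,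
    show -q * (-q * z)⁻¹ = z⁻¹ by field_simp,
    show -q * (w * z⁻¹)⁻¹ = -q * z * w⁻¹ by field_simp, ← div_eq_mul_inv w z]
  generalize qPocInf z⁻¹ q = A at *
  generalize qPocInf (-q * z) q = B at *
  generalize qPocInf (-q) q = C at *
  generalize qPocInf q q = D at *
  field_simp

theorem laurentConv_qBinom_eq {q z : ℂ} (hq0 : q ≠ 0) (hq : ‖q‖ < 1) (h1 : 1 < ‖z‖)
    (h2 : ‖q * z‖ < 1) (m : ℤ) :
    laurentConv (fun n => qBinomCoeff (-q * z) q n * z⁻¹ ^ n) (qBinomCoeff (-q * z) q) m =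
      qPocInf (-q) q / qPocInf z⁻¹ q * (qPocInf (-q * z) q / qPocInf q q) *
        quantumDilog q z m := by
  have hz0 : z ≠ 0 := norm_pos_iff.1 (by linarith)
  obtain ⟨M, rfl | rfl⟩ := m.eq_nat_or_neg
  · have h := quantumDilog_natCast hq0 hq hz0 (one_add_zpow_mul_ne_zero hq0 hq h1 h2) M
    apply mul_right_cancel₀ (pow_ne_zero M hz0)
    rw [mul_assoc _ _ (z ^ M), h, ← qBinomConv_eq hq0 hq h1 h2, laurentConv, qBinomConv,
      ← tsum_mul_right]
    refine tsum_congr fun k => ?_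
    simp only [Int.toNat_natCast, Int.toNat_neg_natCast, add_zero, pow_add, inv_pow]
    field_simp
  · rw [← qBinomConv_eq hq0 hq h1 h2, laurentConv, qBinomConv]
    simp

theorem quantumDilog_series {q z w : ℂ} (hq0 : q ≠ 0) (hq : ‖q‖ < 1) (h1 : 1 < ‖z‖)
    (h2 : ‖q * z‖ < 1) (hw : 1 < ‖w‖) (hwz : ‖w‖ < ‖z‖) :
    Summable (fun m : ℤ => ‖quantumDilog q z m * w ^ m‖) ∧
      HasSum (fun m : ℤ => quantumDilog q z m * w ^ m) (psiZero q z w) := by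
  have hz0 : z ≠ 0 := norm_pos_iff.1 (by linarith)
  have hw0 : w ≠ 0 := norm_pos_iff.1 (by linarith)
  have hx : ‖z⁻¹‖ < 1 := by rw [norm_inv]; exact inv_lt_one_of_one_lt₀ h1
  have hxw : ‖w⁻¹‖ < 1 := by rw [norm_inv]; exact inv_lt_one_of_one_lt₀ hw
  have hy : ‖w / z‖ < 1 := by rw [norm_div]; exact (div_lt_one (by linarith)).2 hwz
  set L := qPocInf (-q) q / qPocInf z⁻¹ q * (qPocInf (-q * z) q / qPocInf q q) with hL
  have hL0 : L ≠ 0 := mul_ne_zero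
    (div_ne_zero (qPocInf_ne_zero hq (by rwa [norm_neg])) (qPocInf_ne_zero hq hx))
    (div_ne_zero (qPocInf_ne_zero hq (by rwa [neg_mul, norm_neg])) (qPocInf_ne_zero hq hq))
  have hfun : laurentConv (fun n => qBinomCoeff (-q * z) q n * (w / z) ^ n)
      (fun n => qBinomCoeff (-q * z) q n * w⁻¹ ^ n) =
        fun m => L * (quantumDilog q z m * w ^ m) := by
    funext m
    rw [← mul_assoc, hL, ← laurentConv_qBinom_eq hq0 hq h1 h2, ← laurentConv_mul_pow _ _ hw0]
    congr 1
    funext n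
    rw [div_eq_mul_inv, mul_pow]
    ring
  have ha := summable_qBinom hq (-q * z) hy
  have hb := summable_qBinom hq (-q * z) hxw
  constructor
  · have h := (laurentConv_norm ha hb).1
    rw [hfun] at h
    simp_rw [norm_mul L] at h
    exact (summable_mul_left_iff (norm_ne_zero_iff.2 hL0)).1 h
  · have h := hasSum_laurentConv ha hb
    rw [hfun, psiZero_mul hq0 hq h1 h2 hw hwz] at h
    exact (hasSum_mul_left_iff hL0).1 h

/-! ### The tetrahedron index -/

theorem choose_two_mul_two (n : ℕ) : 2 * ((n.choose 2 : ℕ) : ℤ) = n * (n - 1) := by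
  induction n with
  | zero => simp
  | succ n ih =>
    rw [Nat.choose_succ_succ' n 1, Nat.choose_one_right]
    push_cast
    linear_combination ih

/-- With l = n + e, the exponent n(n+1) - (2n+e)m + e splits as n(n-1) + (1-m)(n+l), which separates
the two Euler series. -/
theorem IDelta_eq_laurentConv {q : ℂ} (hq0 : q ≠ 0) (m e : ℤ) :
    IDelta m e q = laurentConv (fun n => qBinomCoeff 0 (q ^ 2) n * (-q ^ (1 - m)) ^ n)
      (fun n => eulerCoeff (q ^ 2) n * (-q ^ (1 - m)) ^ n) e := by
  rw [IDelta, tetIndex, laurentConv, ← tsum_mul_left]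
  refine tsum_congr fun k => ?_
  obtain ⟨n, hn⟩ : ∃ n, n = k + (-e).toNat := ⟨_, rfl⟩
  obtain ⟨l, hl⟩ : ∃ l, l = k + e.toNat := ⟨_, rfl⟩
  have he : e = (l : ℤ) - n := by omega
  have hln : ((n : ℤ) + e).toNat = l := by omega
  rw [tetIndexTerm, ← hn, ← hl, hln, qBinomCoeff, eulerCoeff]
  have h0 : qPoc 0 (q ^ 2) l = 1 := by simp [qPoc]
  have hpow : (-q) ^ e * q ^ ((n : ℤ) * (n + 1) - (2 * n + e) * m) =
      (q ^ 2) ^ n.choose 2 * (-q ^ (1 - m)) ^ l * (-q ^ (1 - m)) ^ n := by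
    have h1 : (-q) ^ e = (-1) ^ l * (-1) ^ n * q ^ e := by
      rw [neg_eq_neg_one_mul q, mul_zpow, he, zpow_sub₀ (by norm_num), zpow_natCast, zpow_natCast,
        div_eq_mul_inv, ← inv_pow]
      norm_num
    have h2 : (q ^ 2) ^ n.choose 2 = q ^ ((n : ℤ) * (n - 1)) := by
      rw [← pow_mul, ← zpow_natCast, ← choose_two_mul_two]; push_cast; rfl
    rw [h1, h2, neg_pow (q ^ (1 - m)) l, neg_pow (q ^ (1 - m)) n, ← zpow_natCast (q ^ (1 - m)),
      ← zpow_natCast (q ^ (1 - m)), ← zpow_mul, ← zpow_mul]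
    have h3 : q ^ e * q ^ ((n : ℤ) * (n + 1) - (2 * n + e) * m) =
        q ^ ((n : ℤ) * (n - 1)) * q ^ ((1 - m) * l) * q ^ ((1 - m) * n) := by
      rw [← zpow_add₀ hq0, ← zpow_add₀ hq0, ← zpow_add₀ hq0, he]
      congr 1
      ring
    linear_combination (-1) ^ l * (-1) ^ n * h3
  rw [h0]
  simp only [div_eq_mul_inv, mul_inv]
  linear_combination (-1) ^ n * (qPoc (q ^ 2) (q ^ 2) n)⁻¹ * (qPoc (q ^ 2) (q ^ 2) l)⁻¹ * hpow

theorem IDelta_series {q x : ℂ} (hq0 : q ≠ 0) (hq : ‖q‖ < 1) (hx0 : x ≠ 0) (m : ℤ)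
    (hx : ‖q ^ (1 - m) * x‖ < 1) :
    Summable (fun e => ‖IDelta m e q * x ^ e‖) ∧
      HasSum (fun e => IDelta m e q * x ^ e) (quantumDilog q x m) ∧
      ∑' e, ‖IDelta m e q * x ^ e‖ ≤
        (∑' n, ‖qBinomCoeff 0 (q ^ 2) n * (-q ^ (1 - m) * x) ^ n‖) *
          ∑' n, ‖eulerCoeff (q ^ 2) n * (-q ^ (1 - m) / x) ^ n‖ := by
  have hq2 := norm_sq_lt_one hq
  have hx' : ‖-q ^ (1 - m) * x‖ < 1 := by rwa [neg_mul, norm_neg]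
  have ha := summable_qBinom hq2 0 hx'
  have hb := summable_euler hq2 (-q ^ (1 - m) / x)
  have hfun : laurentConv (fun n => qBinomCoeff 0 (q ^ 2) n * (-q ^ (1 - m) * x) ^ n)
      (fun n => eulerCoeff (q ^ 2) n * (-q ^ (1 - m) / x) ^ n) =
        fun e => IDelta m e q * x ^ e := by
    funext e
    rw [IDelta_eq_laurentConv hq0, ← laurentConv_mul_pow _ _ hx0]
    congr 1 <;> funext n
    · rw [mul_pow]; ring
    · rw [div_eq_mul_inv, mul_pow]; ring
  have h1 := laurentConv_norm ha hb
  have h2 := hasSum_laurentConv ha hb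
  rw [hfun] at h1 h2
  rw [tsum_qBinom hq2 0 hx', tsum_euler hq2, zero_mul, qPocInf_zero, one_div_mul_eq_div] at h2
  exact ⟨h1.1, h2, h1.2⟩

/-- At m = -M both Euler arguments are those at m = 0 scaled by q^M, so M = 0 dominates. -/
theorem exists_tsum_norm_IDelta_le {q z : ℂ} (hq : ‖q‖ < 1) (hq0 : q ≠ 0) (hz0 : z ≠ 0)
    (hz : ‖q * z‖ < 1) :
    ∃ C : ℝ, ∀ M : ℕ, ∑' e, ‖IDelta (-M) e q * z ^ e‖ ≤ C := by
  have hq2 := norm_sq_lt_one hq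
  have hz' : ‖-q * z‖ < 1 := by rwa [neg_mul, norm_neg]
  have ha := summable_qBinom hq2 0 hz'
  have hb := summable_euler hq2 (-q / z)
  refine ⟨(∑' n, ‖qBinomCoeff 0 (q ^ 2) n * (-q * z) ^ n‖) *
    ∑' n, ‖eulerCoeff (q ^ 2) n * (-q / z) ^ n‖, fun M => ?_⟩
  have hpow : q ^ (1 - -(M : ℤ)) = q ^ M * q := by
    rw [← pow_succ, ← zpow_natCast]; congr 1; push_cast; ring
  have h := (IDelta_series hq0 hq hz0 (-M) (by
    rw [hpow, mul_assoc]; exact norm_pow_mul_lt_one hq hz M)).2.2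
  refine h.trans ?_
  rw [hpow, show -(q ^ M * q) * z = q ^ M * (-q * z) by ring,
    show -(q ^ M * q) / z = q ^ M * (-q / z) by ring]
  refine mul_le_mul
    ((summable_mul_pow_of_scale hq ha M).tsum_le_tsum (fun n => norm_mul_pow_mul_le hq _ _ _ _) ha)
    ((summable_mul_pow_of_scale hq hb M).tsum_le_tsum (fun n => norm_mul_pow_mul_le hq _ _ _ _) hb)
    (tsum_nonneg fun _ => norm_nonneg _) (tsum_nonneg fun _ => norm_nonneg _)

theorem IDelta_natCast {q z : ℂ} (hq0 : q ≠ 0) (hq : ‖q‖ < 1) (h1 : 1 < ‖z‖)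
    (h2 : ‖q * z‖ < 1) (M : ℕ) (e : ℤ) : IDelta M e q = IDelta (-M) (e + M) q := by
  have hz0 : z ≠ 0 := norm_pos_iff.1 (by linarith)
  have key : ∀ u : ℂ, ‖u‖ = 1 →
      Summable (fun e : ℤ => ‖(IDelta M (e - M) q - IDelta (-M) e q) * (q ^ M * z * u) ^ e‖) ∧
      HasSum (fun e : ℤ => (IDelta M (e - M) q - IDelta (-M) e q) * (q ^ M * z * u) ^ e) 0 := by
    intro u hu
    have hu0 : u ≠ 0 := norm_pos_iff.1 (by linarith)
    -- This circle has |q^{1-M} x| = |qz| < 1, so the expansions for M and -M both converge on it.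
    set x := q ^ M * z * u with hx
    have hx0 : x ≠ 0 := mul_ne_zero (mul_ne_zero (pow_ne_zero _ hq0) hz0) hu0
    have hne : ∀ j : ℤ, 1 + q ^ j * x ≠ 0 := fun j => by
      have := one_add_zpow_mul_ne_zero (z := z * u) hq0 hq (by rwa [norm_mul, hu, mul_one])
        (by rwa [← mul_assoc, norm_mul, hu, mul_one]) (j + M)
      rwa [zpow_add₀ hq0, zpow_natCast, mul_assoc, ← mul_assoc (q ^ M)] at this
    have b1 : ‖q ^ (1 - (M : ℤ)) * x‖ < 1 := by
      rw [show q ^ (1 - (M : ℤ)) * x = q * z * u by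
        rw [zpow_sub₀ hq0, zpow_one, zpow_natCast, hx]
        have := pow_ne_zero M hq0
        field_simp]
      rwa [norm_mul, hu, mul_one]
    have b2 : ‖q ^ (1 - -(M : ℤ)) * x‖ < 1 := by
      rw [show q ^ (1 - -(M : ℤ)) * x = q ^ (2 * M) * (q * z * u) by
        rw [show 1 - -(M : ℤ) = ((M + 1 : ℕ) : ℤ) by push_cast; ring, zpow_natCast, hx]; ring]
      exact norm_pow_mul_lt_one hq (by rwa [norm_mul, hu, mul_one]) _
    obtain ⟨s1, t1, -⟩ := IDelta_series hq0 hq hx0 M b1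
    obtain ⟨s2, t2, -⟩ := IDelta_series hq0 hq hx0 (-M) b2
    have hsh : ∀ e : ℤ, IDelta M (e - M) q * x ^ (e - M) * x ^ M = IDelta M (e - M) q * x ^ e := by
      intro e
      rw [mul_assoc, ← zpow_natCast, ← zpow_add₀ hx0, sub_add_cancel]
    have t3 := ((Equiv.subRight (M : ℤ)).hasSum_iff.2 t1).mul_right (x ^ M)
    have s3 := ((Equiv.subRight (M : ℤ)).summable_iff.2 s1).mul_right ‖x ^ M‖
    simp only [Function.comp_def, Equiv.subRight_apply, ← norm_mul, hsh] at t3 s3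
    rw [quantumDilog_natCast hq0 hq hx0 hne] at t3
    have t4 := t3.sub t2
    rw [sub_self] at t4
    simp only [sub_mul]
    exact ⟨(s3.add s2).of_nonneg_of_le (fun _ => norm_nonneg _) (fun _ => norm_sub_le _ _), t4⟩
  have hs := (key 1 norm_one).1
  simp only [mul_one] at hs
  have h := laurent_coeff_eq_zero hs (fun u hu => by
    refine (congrArg (HasSum · (0 : ℂ)) (funext fun e => ?_)).mp (key u hu).2
    rw [mul_zpow _ u, mul_assoc]) (e + M)
  rw [mul_eq_zero, or_iff_left
    (zpow_ne_zero _ (mul_ne_zero (pow_ne_zero _ hq0) hz0)), add_sub_cancel_right] at h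
  exact sub_eq_zero.1 h

/-- The Laurent expansion of `ψ(z,m)` on the annulus `1 < |z| < |q|⁻¹`, with a bound on the sum of
the norms of its terms. -/
theorem exists_IDelta_expansion {q z : ℂ} (hq0 : q ≠ 0) (hq : ‖q‖ < 1) (h1 : 1 < ‖z‖)
    (h2 : ‖q * z‖ < 1) :
    (∀ m : ℤ, Summable (fun e => ‖IDelta m e q * z ^ e‖) ∧
      HasSum (fun e => IDelta m e q * z ^ e) (quantumDilog q z m)) ∧
    ∃ C : ℝ, ∀ M : ℕ, ∑' e, ‖IDelta (-M) e q * z ^ e‖ ≤ C ∧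
      ∑' e, ‖IDelta M e q * z ^ e‖ ≤ C * (‖z‖ ^ M)⁻¹ := by
  have hz0 : z ≠ 0 := norm_pos_iff.1 (by linarith)
  have hneg : ∀ M : ℕ, Summable (fun e => ‖IDelta (-M) e q * z ^ e‖) ∧
      HasSum (fun e => IDelta (-M) e q * z ^ e) (quantumDilog q z (-M)) := fun M => by
    have h := IDelta_series hq0 hq hz0 (-M) (by
      rw [show 1 - -(M : ℤ) = ((M + 1 : ℕ) : ℤ) by push_cast; ring, zpow_natCast, pow_succ,
        mul_assoc]
      exact norm_pow_mul_lt_one hq h2 M)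
    exact ⟨h.1, h.2.1⟩
  have hsh : ∀ (M : ℕ) (e : ℤ), IDelta M e q * z ^ e =
      IDelta (-M) (e + M) q * z ^ (e + M) * (z ^ M)⁻¹ := fun M e => by
    rw [IDelta_natCast hq0 hq h1 h2, zpow_add₀ hz0, zpow_natCast]
    field_simp
  refine ⟨fun m => ?_, ?_⟩
  · obtain ⟨M, rfl | rfl⟩ := m.eq_nat_or_neg
    -- For M ≥ 1, |q^{1-M} z| > 1 puts `IDelta_series` out of reach; the series for -M is shifted
    -- instead.
    · have t := ((Equiv.addRight (M : ℤ)).hasSum_iff.2 (hneg M).2).mul_right (z ^ M)⁻¹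
      have s := ((Equiv.addRight (M : ℤ)).summable_iff.2 (hneg M).1).mul_right ‖(z ^ M)⁻¹‖
      simp only [Function.comp_def, Equiv.coe_addRight, ← norm_mul, ← hsh] at t s
      rw [← quantumDilog_natCast hq0 hq hz0 (one_add_zpow_mul_ne_zero hq0 hq h1 h2),
        mul_inv_cancel_right₀ (pow_ne_zero _ hz0)] at t
      exact ⟨s, t⟩
    · exact hneg M
  · obtain ⟨C, hC⟩ := exists_tsum_norm_IDelta_le hq hq0 hz0 h2
    refine ⟨C, fun M => ⟨hC M, ?_⟩⟩
    simp_rw [hsh M, norm_mul _ (z ^ M)⁻¹]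
    have hshift := (Equiv.addRight (M : ℤ)).tsum_eq (fun e => ‖IDelta (-M) e q * z ^ e‖)
    simp only [Equiv.coe_addRight] at hshift
    rw [tsum_mul_right, hshift, norm_inv, norm_pow]
    exact mul_le_mul_of_nonneg_right (hC M) (by positivity)

/-- The sums over e are dominated by geometric series of ratio |w|/|z| for m ≥ 0 and 1/|w| for m ≤
0, which is where 1 < |w| < |z| enters. -/
theorem summable_IDelta {q z w : ℂ} (hq0 : q ≠ 0) (hq : ‖q‖ < 1) (h1 : 1 < ‖z‖)
    (h2 : ‖q * z‖ < 1) (hw : 1 < ‖w‖) (hwz : ‖w‖ < ‖z‖) :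
    Summable (fun me : ℤ × ℤ => ‖IDelta me.1 me.2 q * z ^ me.2 * w ^ me.1‖) := by
  obtain ⟨hexp, C, hC⟩ := exists_IDelta_expansion hq0 hq h1 h2
  have hn : ∀ m e : ℤ, ‖IDelta m e q * z ^ e * w ^ m‖ = ‖IDelta m e q * z ^ e‖ * ‖w ^ m‖ :=
    fun m e => norm_mul _ _
  refine (summable_prod_of_nonneg fun _ => norm_nonneg _).2 ⟨fun m => ?_, ?_⟩
  · simp_rw [hn]
    exact (hexp m).1.mul_right _
  · simp_rw [hn, tsum_mul_right]
    have hnn : ∀ m : ℤ, 0 ≤ (∑' e, ‖IDelta m e q * z ^ e‖) * ‖w ^ m‖ := fun m =>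
      mul_nonneg (tsum_nonneg fun _ => norm_nonneg _) (norm_nonneg _)
    refine Summable.of_nat_of_neg ?_ ?_
    · have hr : ‖w‖ / ‖z‖ < 1 := (div_lt_one (by linarith)).2 hwz
      refine ((summable_geometric_of_lt_one (by positivity) hr).mul_left C).of_nonneg_of_le
        (fun M => hnn M) fun M => ?_
      rw [zpow_natCast, norm_pow, div_pow, div_eq_inv_mul, ← mul_assoc]
      exact mul_le_mul_of_nonneg_right (hC M).2 (by positivity)
    · have hr : ‖w‖⁻¹ < 1 := inv_lt_one_of_one_lt₀ hw
      refine ((summable_geometric_of_lt_one (by positivity) hr).mul_left C).of_nonneg_of_le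
        (fun M => hnn _) fun M => ?_
      rw [zpow_neg, zpow_natCast, norm_inv, norm_pow, inv_pow]
      exact mul_le_mul_of_nonneg_right (hC M).1 (by positivity)

theorem mainTheorem4 (q z w : ℂ) (hq0 : q ≠ 0) (hq1 : ‖q‖ < 1)
    (hw : 1 < ‖w‖) (hwz : ‖w‖ < ‖z‖) (hz : ‖z‖ < ‖q‖⁻¹) :
    (Summable (fun m : ℤ => ‖quantumDilog q z m * w ^ m‖) ∧
      HasSum (fun m : ℤ => quantumDilog q z m * w ^ m) (psiZero q z w)) ∧
    (Summable (fun em : ℤ × ℤ => ‖IDelta em.2 em.1 q * z ^ em.1 * w ^ em.2‖) ∧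
      HasSum (fun em : ℤ × ℤ => IDelta em.2 em.1 q * z ^ em.1 * w ^ em.2)
        (psiZero q z w)) := by
  have h1 : 1 < ‖z‖ := hw.trans hwz
  have hq' : 0 < ‖q‖ := norm_pos_iff.2 hq0
  have h2 : ‖q * z‖ < 1 := by
    rw [norm_mul, ← mul_inv_cancel₀ hq'.ne']
    exact mul_lt_mul_of_pos_left hz hq'
  have hA := quantumDilog_series hq0 hq1 h1 h2 hw hwz
  have hS := summable_IDelta hq0 hq1 h1 h2 hw hwz
  have hexp := (exists_IDelta_expansion hq0 hq1 h1 h2).1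
  have hsum := hS.of_norm.hasSum
  -- Summing over e first turns the double series into the series of (a), which identifies its
  -- value.
  have heq := (hsum.prod_fiberwise fun m => ((hexp m).2.mul_right (w ^ m))).unique hA.2
  rw [heq] at hsum
  have hS' := (Equiv.prodComm ℤ ℤ).summable_iff.2 hS
  have hsum' := (Equiv.prodComm ℤ ℤ).hasSum_iff.2 hsum
  simp only [Function.comp_def, Equiv.prodComm_apply, Prod.fst_swap, Prod.snd_swap] at hS' hsum'
  exact ⟨hA, hS', hsum'⟩
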